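/- Let $(E,d)$ be a metric space. For each $x\in E$ let $F(\cdot,x)$ be the distribution function of a probability law on $\mathbb R$ (the conditional law of a response $Y$ given the covariate $x$), and let $q(\alpha,x)$ be the conditional quantile of order $1-\alpha$, that is, $F(q(\alpha,x),x)=1-\alpha$ for all $\alpha\in(0,1)$, $x\in E$. Assume that these laws are heavy-tailed: there is $\gamma:E\to(0,\infty)$ with $\lim_{\alpha\to0}q(\lambda\alpha,x)/q(\alpha,x)=\lambda^{-\gamma(x)}$ for all $\lambda>0$ and $x\in E$. Fix $t\in E$ and assume **(A)** the function $\alpha\in(0,1)\mapsto q(\alpha,t)\in(0,\infty)$ is differentiable, and $\Delta(\alpha,t)=\gamma(t)+\alpha\,\frac{\partial\log q}{\partial\alpha}(\alpha,t)$ is continuous in $\alpha\in(0,1)$ with $\lim_{\alpha\to0}\Delta(\alpha,t)=0$. For each $n$ let $x_1,\dots,x_n\in E$ be nonrandom design points (possibly depending on $n$) and let $Y_1,\dots,Y_n$ be independent real random variables, $Y_i$ having distribution function $F(\cdot,x_i)$. Let $h_t=h_{n,t}>0$ with $h_t\to0$ as $n\to\infty$, let $B(t,h_t)=\{x\in E: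 d(x,t)\le h_t\}$, and assume that $q(\alpha,x)>0$ for all $\alpha\in(0,1)$ and $x\in B(t,h_t)$. Let $m_t=m_{n,t}$ be the number of $i\le n$ with $x_i\in B(t,h_t)$, assume $m_t\to\infty$ as $n\to\infty$, and let $Z_{m_t,m_t}$ be the largest of the $Y_i$ with $x_i\in B(t,h_t)$. For $a\in(0,1/2)$ put $$\omega_n(a)=\sup\Big\{\Big|\log\frac{q(\alpha,x)}{q(\alpha,x')}\Big| : \alpha\in(a,1-a),\ (x,x')\in B(t,h_t)^2\Big\}\in[0,\infty].$$ Let $\alpha_{m_t}\in(0,1)$ be a sequence (indexed by $n$), and consider the situations * **(S.1)** $\alpha_{m_t}\to0$ and $m_t\alpha_{m_t}\to\infty$; * **(S.2)** $\alpha_{m_t}\to0$, $m_t\alpha_{m_t}\to c\in[1,\infty)$ and $\lfloor m_t\alpha_{m_t}\rfloor\to\lfloor c\rfloor$; * **(S.3)** $\alpha_{m_t}\to0$ and $m_t\alpha_{m_t}\to c\in[0,1)$. If $\omega_n(m_t^{-(1+\delta)})\to0$ as $n\to\infty$ for some $\delta>0$, then * under (S.1), $\mathbb P(Z_{m_t,m_t}<q(\alpha_{m_t},t))\to0$;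 * under (S.2) or (S.3), $\mathbb P(Z_{m_t,m_t}<q(\alpha_{m_t},t))\to e^{-c}$. -/

import Mathlib

open Filter Topology MeasureTheory ProbabilityTheory

noncomputable section

namespace ConditionalExtremes

/-- `q α x` is a quantile of order `1 - α` of the law `ν x` (the conditional law of the response
given the covariate `x`): `F (q α x, x) = 1 - α`, where `F (·, x)` is the distribution function
of `ν x`. -/
def IsConditionalQuantile {E : Type*} (ν : E → Measure ℝ) (q : ℝ → E → ℝ) : Prop :=
  ∀ x : E, ∀ α ∈ Set.Ioo (0 : ℝ) 1, cdf (ν x) (q α x) = 1 - α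

/-- Heavy tails: for every `x`, `γ x > 0` and `q (·, x)` is regularly varying at `0` with index
`-γ x`. -/
def IsHeavyTailed {E : Type*} (q : ℝ → E → ℝ) (γ : E → ℝ) : Prop :=
  ∀ x : E, 0 < γ x ∧ ∀ lam : ℝ, 0 < lam →
    Tendsto (fun α : ℝ => q (lam * α) x / q α x) (𝓝[>] 0) (𝓝 (lam ^ (-γ x)))

/-- `Δ(α) = g + α (log Q)'(α)`, for a quantile function `Q` with tail index `g`. -/
def tailDelta (Q : ℝ → ℝ) (g : ℝ) (α : ℝ) : ℝ :=
  g + α * deriv (fun a : ℝ => Real.log (Q a)) α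

/-- Condition (A) on the quantile function `Q = q (·, t)` with tail index `g = γ t`. -/
structure ConditionA (Q : ℝ → ℝ) (g : ℝ) : Prop where
  pos : ∀ α ∈ Set.Ioo (0 : ℝ) 1, 0 < Q α
  differentiableOn : DifferentiableOn ℝ Q (Set.Ioo 0 1)
  continuousOn : ContinuousOn (tailDelta Q g) (Set.Ioo 0 1)
  tendsto_zero : Tendsto (tailDelta Q g) (𝓝[>] 0) (𝓝 0)

/-- The largest oscillation of the log-quantile function over the closed ball `B(t, r)`, for
quantile levels in `(a, 1 - a)`. The supremum is taken in `[0, ∞]`, so that an unbounded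
oscillation has the value `∞`. -/
def logOscillation {E : Type*} [MetricSpace E] (q : ℝ → E → ℝ) (t : E) (r a : ℝ) : ENNReal :=
  ⨆ (α ∈ Set.Ioo a (1 - a)) (x ∈ Metric.closedBall t r) (x' ∈ Metric.closedBall t r),
    ENNReal.ofReal |Real.log (q α x / q α x')|

/-- The number of design points in the closed ball `B(t, r)`. -/
def sliceCount {E : Type*} [MetricSpace E] {n : ℕ} (x : Fin n → E) (t : E) (r : ℝ) : ℕ :=
  Nat.card {i : Fin n // x i ∈ Metric.closedBall t r}

/-- The largest response (the largest order statistic) among the observations `(y i, x i)` whose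
design point lies in the closed ball `B(t, r)`. It is meaningful when there is at least one such
observation (it is `0` otherwise). -/
def sliceMax {E : Type*} [MetricSpace E] {n : ℕ} (x : Fin n → E) (y : Fin n → ℝ) (t : E)
    (r : ℝ) : ℝ :=
  ⨆ i : {i : Fin n // x i ∈ Metric.closedBall t r}, y i

/-- Situation (S.1): `α n → 0` and `m n * α n → ∞`. -/
def SituationOne (m : ℕ → ℕ) (α : ℕ → ℝ) : Prop :=
  Tendsto α atTop (𝓝 0) ∧ Tendsto (fun n => (m n : ℝ) * α n) atTop atTop

/-- Situation (S.2): `α n → 0`, `m n * α n → c ∈ [1, ∞)` and `⌊m n * α n⌋ → ⌊c⌋`. -/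
def SituationTwo (m : ℕ → ℕ) (α : ℕ → ℝ) (c : ℝ) : Prop :=
  Tendsto α atTop (𝓝 0) ∧ 1 ≤ c ∧ Tendsto (fun n => (m n : ℝ) * α n) atTop (𝓝 c) ∧
    Tendsto (fun n => ⌊(m n : ℝ) * α n⌋) atTop (𝓝 ⌊c⌋)

/-- Situation (S.3): `α n → 0` and `m n * α n → c ∈ [0, 1)`. -/
def SituationThree (m : ℕ → ℕ) (α : ℕ → ℝ) (c : ℝ) : Prop :=
  Tendsto α atTop (𝓝 0) ∧ 0 ≤ c ∧ c < 1 ∧ Tendsto (fun n => (m n : ℝ) * α n) atTop (𝓝 c)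

end ConditionalExtremes

end

namespace ConditionalExtremes

/-! ### Comparison of quantiles across the window. -/

section Quantiles

variable {E : Type*} {q : ℝ → E → ℝ}

/-! By independence the probability is a product of `m` values of distribution functions just below
`q α t`. These are compared with the exact value `1 - lam * α`, taken at `q (lam * α) x`. Regular
variation at `t` makes `q (lam * α) t / q α t` tend to `lam ^ (-γ t)`, which is bounded away from
`1` when `lam ≠ 1`. Moving from `t` to another point of the window costs a factor at most `exp ω`,
which tends to `1` and cannot fill this gap (`eventually_quantile_lt_center`,
`eventually_center_lt_quantile`). The probability thus lies between powers `(1 - lam * α) ^ m` with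
`lam` on either side of `1`. These behave like `exp (-lam * m * α)`, and `lam → 1` finishes.

The comparison needs `lam * α > m ^ (-(1 + δ))`, which may fail when `m * α → 0`. Then `α` is first
raised to at least `η / m`, which can only lower the probability. -/

theorem IsConditionalQuantile.lt_of_lt {ν : E → Measure ℝ} (hq : IsConditionalQuantile ν q)
    (x : E) {a b : ℝ} (ha : a ∈ Set.Ioo (0 : ℝ) 1) (hb : b ∈ Set.Ioo (0 : ℝ) 1) (hab : a < b) :
    q b x < q a x := by
  by_contra! hle
  have := monotone_cdf (ν x) hle
  rw [hq x a ha, hq x b hb] at this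
  linarith

theorem IsHeavyTailed.tendsto_div_of_pos {γ : E → ℝ} {β : ℕ → ℝ}
    (hheavy : IsHeavyTailed q γ) (t : E)
    (hβ : ∀ n, 0 < β n) (hβ0 : Tendsto β atTop (𝓝 0)) {lam : ℝ} (hlam : 0 < lam) :
    Tendsto (fun n => q (lam * β n) t / q (β n) t) atTop (𝓝 (lam ^ (-γ t))) :=
  ((hheavy t).2 lam hlam).comp
    (tendsto_nhdsWithin_iff.2 ⟨hβ0, Eventually.of_forall hβ⟩)

variable [MetricSpace E]

theorem abs_log_div_le_logOscillation {t : E} {r a : ℝ} (hfin : logOscillation q t r a ≠ ⊤)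
    {b : ℝ} (hb : b ∈ Set.Ioo a (1 - a)) {x x' : E} (hx : x ∈ Metric.closedBall t r)
    (hx' : x' ∈ Metric.closedBall t r) :
    |Real.log (q b x / q b x')| ≤ (logOscillation q t r a).toReal := by
  rw [← ENNReal.ofReal_le_iff_le_toReal hfin]
  exact le_iSup₂_of_le b hb (le_iSup₂_of_le x hx (le_iSup₂_of_le x' hx' le_rfl))

theorem le_exp_logOscillation_mul {t : E} {r a : ℝ} (hfin : logOscillation q t r a ≠ ⊤)
    {b : ℝ} (hb : b ∈ Set.Ioo a (1 - a)) {x x' : E} (hx : x ∈ Metric.closedBall t r)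
    (hx' : x' ∈ Metric.closedBall t r) (hqx : 0 < q b x) (hqx' : 0 < q b x') :
    q b x ≤ Real.exp (logOscillation q t r a).toReal * q b x' := by
  have h := (abs_le.1 (abs_log_div_le_logOscillation hfin hb hx hx')).2
  rwa [Real.log_le_iff_le_exp (div_pos hqx hqx'), div_le_iff₀ hqx'] at h

variable {γ : E → ℝ} {t : E} {r a β : ℕ → ℝ}

theorem eventually_mul_mem_Ioo (hβ0 : Tendsto β atTop (𝓝 0)) (ha : Tendsto a atTop (𝓝 0))
    {lam : ℝ} (hlow : ∀ᶠ n in atTop, a n < lam * β n) :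
    ∀ᶠ n in atTop, lam * β n ∈ Set.Ioo (a n) (1 - a n) := by
  have h1 : Tendsto (fun n => lam * β n + a n) atTop (𝓝 0) := by
    simpa using (hβ0.const_mul lam).add ha
  filter_upwards [hlow, h1.eventually_lt_const one_pos] with n h2 h3
  exact ⟨h2, by linarith⟩

theorem tendsto_exp_toReal_logOscillation
    (hosc : Tendsto (fun n => logOscillation q t (r n) (a n)) atTop (𝓝 0)) :
    Tendsto (fun n => Real.exp (logOscillation q t (r n) (a n)).toReal) atTop (𝓝 1) := by
  have h := (ENNReal.tendsto_toReal ENNReal.zero_ne_top).comp hosc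
  rw [← Real.exp_zero, ← ENNReal.toReal_zero]
  exact (Real.continuous_exp.tendsto _).comp h

/-- Needed because `toReal` sends `⊤` to `0`, so a real-valued bound means nothing until the
oscillation is finite. -/
theorem eventually_logOscillation_ne_top
    (hosc : Tendsto (fun n => logOscillation q t (r n) (a n)) atTop (𝓝 0)) :
    ∀ᶠ n in atTop, logOscillation q t (r n) (a n) ≠ ⊤ := by
  filter_upwards [hosc.eventually_lt_const ENNReal.zero_lt_top] with n hn using hn.ne

/-- At a level multiplied by `lam > 1`, all quantiles over the shrinking window fall below the
quantile at the centre. -/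
theorem eventually_quantile_lt_center (hheavy : IsHeavyTailed q γ) (hr : ∀ n, 0 < r n)
    (hqpos : ∀ n, ∀ x ∈ Metric.closedBall t (r n), ∀ b ∈ Set.Ioo (0 : ℝ) 1, 0 < q b x)
    (hosc : Tendsto (fun n => logOscillation q t (r n) (a n)) atTop (𝓝 0))
    (ha0 : ∀ n, 0 ≤ a n) (ha : Tendsto a atTop (𝓝 0))
    (hβ : ∀ n, 0 < β n) (hβ0 : Tendsto β atTop (𝓝 0)) {lam : ℝ} (hlam : 1 < lam)
    (hlow : ∀ᶠ n in atTop, a n < lam * β n) :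
    ∀ᶠ n in atTop, ∀ x ∈ Metric.closedBall t (r n), q (lam * β n) x < q (β n) t := by
  -- The factor paid for moving to any `x` is included in this limit, so the conclusion is uniform
  -- over the window.
  have hlim := (tendsto_exp_toReal_logOscillation hosc).mul
    (hheavy.tendsto_div_of_pos t hβ hβ0 (one_pos.trans hlam))
  have hlt : 1 * lam ^ (-γ t) < 1 := by
    rw [one_mul]
    exact Real.rpow_lt_one_of_one_lt_of_neg hlam (neg_neg_of_pos (hheavy t).1)
  filter_upwards [hlim.eventually_lt_const hlt, eventually_logOscillation_ne_top hosc,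
    eventually_mul_mem_Ioo hβ0 ha hlow, hβ0.eventually_lt_const one_pos] with n h1 h2 h3 h4 x hx
  have ht : t ∈ Metric.closedBall t (r n) := Metric.mem_closedBall_self (hr n).le
  have h5 : lam * β n ∈ Set.Ioo (0 : ℝ) 1 :=
    ⟨(ha0 n).trans_lt h3.1, by linarith [h3.2, ha0 n]⟩
  have h6 := hqpos n t ht (β n) ⟨hβ n, h4⟩
  rw [← mul_div_assoc, div_lt_one h6] at h1
  exact (le_exp_logOscillation_mul h2 h3 hx ht (hqpos n x hx _ h5) (hqpos n t ht _ h5)).trans_lt h1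

/-- At a level multiplied by `lam < 1`, all quantiles over the shrinking window lie above the
quantile at the centre. -/
theorem eventually_center_lt_quantile (hheavy : IsHeavyTailed q γ) (hr : ∀ n, 0 < r n)
    (hqpos : ∀ n, ∀ x ∈ Metric.closedBall t (r n), ∀ b ∈ Set.Ioo (0 : ℝ) 1, 0 < q b x)
    (hosc : Tendsto (fun n => logOscillation q t (r n) (a n)) atTop (𝓝 0))
    (ha0 : ∀ n, 0 ≤ a n) (ha : Tendsto a atTop (𝓝 0))
    (hβ : ∀ n, 0 < β n) (hβ0 : Tendsto β atTop (𝓝 0)) {lam : ℝ} (hlam0 : 0 < lam)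
    (hlam : lam < 1) (hlow : ∀ᶠ n in atTop, a n < lam * β n) :
    ∀ᶠ n in atTop, ∀ x ∈ Metric.closedBall t (r n), q (β n) t < q (lam * β n) x := by
  have hlim := (hheavy.tendsto_div_of_pos t hβ hβ0 hlam0).div
    (tendsto_exp_toReal_logOscillation hosc) one_ne_zero
  have hlt : 1 < lam ^ (-γ t) / 1 := by
    rw [div_one]
    exact Real.one_lt_rpow_of_pos_of_lt_one_of_neg hlam0 hlam (neg_neg_of_pos (hheavy t).1)
  filter_upwards [hlim.eventually_const_lt hlt, eventually_logOscillation_ne_top hosc,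
    eventually_mul_mem_Ioo hβ0 ha hlow, hβ0.eventually_lt_const one_pos] with n h1 h2 h3 h4 x hx
  have ht : t ∈ Metric.closedBall t (r n) := Metric.mem_closedBall_self (hr n).le
  have h5 : lam * β n ∈ Set.Ioo (0 : ℝ) 1 :=
    ⟨(ha0 n).trans_lt h3.1, by linarith [h3.2, ha0 n]⟩
  have h6 := hqpos n t ht (β n) ⟨hβ n, h4⟩
  have h7 := le_exp_logOscillation_mul h2 h3 ht hx (hqpos n t ht _ h5) (hqpos n x hx _ h5)
  simp only [Pi.div_apply] at h1
  rw [lt_div_iff₀ (Real.exp_pos _), one_mul, lt_div_iff₀ h6] at h1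
  exact lt_of_mul_lt_mul_left (h1.trans_le h7) (Real.exp_pos _).le

end Quantiles

/-! ### Law of the maximum over a slice. -/

section SliceMaximum

variable {E : Type*} [MetricSpace E] {Ω : Type*} [MeasurableSpace Ω] {P : Measure Ω}
  {ν : E → Measure ℝ} {n : ℕ} {x : Fin n → E} {Y : Fin n → Ω → ℝ} {t : E} {r : ℝ}

theorem sliceMax_lt_iff {y : Fin n → ℝ} (hne : 0 < sliceCount x t r) (u : ℝ) :
    sliceMax x y t r < u ↔ ∀ i : {i : Fin n // x i ∈ Metric.closedBall t r}, y i < u := by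
  -- On an empty slice the supremum would be the default `0`, whereas the condition on the right
  -- would hold vacuously.
  have : Nonempty {i : Fin n // x i ∈ Metric.closedBall t r} := (Nat.card_pos_iff.1 hne).1
  refine ⟨fun h i => (le_ciSup (Set.finite_range _).bddAbove i).trans_lt h, fun h => ?_⟩
  obtain ⟨i, hi⟩ := exists_eq_ciSup_of_finite
    (f := fun i : {i : Fin n // x i ∈ Metric.closedBall t r} => y i)
  rw [sliceMax, ← hi]
  exact h i

open Classical in
theorem measureReal_sliceMax_lt (hlaw : ∀ i, HasLaw (Y i) (ν (x i)) P) (hindep : iIndepFun Y P)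
    (hne : 0 < sliceCount x t r) (u : ℝ) :
    P.real {ω | sliceMax x (fun i => Y i ω) t r < u} =
      ∏ i : {i : Fin n // x i ∈ Metric.closedBall t r}, (ν (x i)).real (Set.Iio u) := by
  have hset : {ω | sliceMax x (fun i => Y i ω) t r < u} =
      ⋂ i ∈ (Finset.univ : Finset {i : Fin n // x i ∈ Metric.closedBall t r}),
        Y i ⁻¹' Set.Iio u := by
    ext ω
    simp [sliceMax_lt_iff hne]
  have hind : iIndepFun (fun i : {i : Fin n // x i ∈ Metric.closedBall t r} => Y i) P :=
    hindep.precomp Subtype.val_injective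
  rw [hset, Measure.real, hind.measure_inter_preimage_eq_mul Finset.univ
    (fun _ _ => measurableSet_Iio), ENNReal.toReal_prod]
  refine Finset.prod_congr rfl fun i _ => ?_
  exact (hlaw i).measureReal_eq measurableSet_Iio

theorem pow_le_measureReal_sliceMax_lt (hlaw : ∀ i, HasLaw (Y i) (ν (x i)) P)
    (hindep : iIndepFun Y P) (hne : 0 < sliceCount x t r) {u p : ℝ} (hp : 0 ≤ p)
    (hle : ∀ z ∈ Metric.closedBall t r, p ≤ (ν z).real (Set.Iio u)) :
    p ^ sliceCount x t r ≤ P.real {ω | sliceMax x (fun i => Y i ω) t r < u} := by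
  classical
  rw [measureReal_sliceMax_lt hlaw hindep hne, sliceCount, Nat.card_eq_fintype_card,
    ← Finset.card_univ, ← Finset.prod_const]
  exact Finset.prod_le_prod (fun _ _ => hp) fun i _ => hle _ i.2

theorem measureReal_sliceMax_lt_le_pow (hlaw : ∀ i, HasLaw (Y i) (ν (x i)) P)
    (hindep : iIndepFun Y P) (hne : 0 < sliceCount x t r) {u p : ℝ}
    (hle : ∀ z ∈ Metric.closedBall t r, (ν z).real (Set.Iio u) ≤ p) :
    P.real {ω | sliceMax x (fun i => Y i ω) t r < u} ≤ p ^ sliceCount x t r := by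
  classical
  rw [measureReal_sliceMax_lt hlaw hindep hne, sliceCount, Nat.card_eq_fintype_card,
    ← Finset.card_univ, ← Finset.prod_const]
  exact Finset.prod_le_prod (fun _ _ => measureReal_nonneg) fun i _ => hle _ i.2

end SliceMaximum

/-! ### Exponential bounds for powers, and admissible levels. -/

theorem one_sub_pow_le_exp {y : ℝ} (hy : y ≤ 1) (m : ℕ) :
    (1 - y) ^ m ≤ Real.exp (-(m * y)) := by
  calc (1 - y) ^ m ≤ Real.exp (-y) ^ m :=
        pow_le_pow_left₀ (by linarith) (Real.one_sub_le_exp_neg y) m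
    _ = Real.exp (-(m * y)) := by rw [← Real.exp_nat_mul, mul_neg]

/-- This is `1 - 1 / z ≤ log z` at `z = 1 - y`, raised to the power `m`. -/
theorem exp_le_one_sub_pow {y : ℝ} (hy : y < 1) (m : ℕ) :
    Real.exp (-(m * y / (1 - y))) ≤ (1 - y) ^ m := by
  have h1 : 0 < 1 - y := by linarith
  have h2 : Real.exp (-(y / (1 - y))) ≤ 1 - y := by
    rw [← Real.le_log_iff_exp_le h1]
    refine le_trans (le_of_eq ?_) (Real.one_sub_inv_le_log_of_pos h1)
    field_simp
    ring
  calc Real.exp (-(m * y / (1 - y))) = Real.exp (-(y / (1 - y))) ^ m := by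
        rw [← Real.exp_nat_mul]; ring_nf
    _ ≤ _ := pow_le_pow_left₀ (Real.exp_pos _).le h2 m

section Levels

variable {m : ℕ → ℕ} {β : ℕ → ℝ}

theorem tendsto_natCast_rpow_neg (hm : Tendsto m atTop atTop) {s : ℝ} (hs : 0 < s) :
    Tendsto (fun n => (m n : ℝ) ^ (-s)) atTop (𝓝 0) :=
  (tendsto_rpow_neg_atTop hs).comp (tendsto_natCast_atTop_atTop.comp hm)

/-- The spare factor `m ^ (-δ)` tends to `0`, so it eventually drops below any fixed floor for `m *
β`. -/
theorem eventually_rpow_lt_of_le_mul (hm : Tendsto m atTop atTop) {δ : ℝ} (hδ : 0 < δ) {ε : ℝ}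
    (hε : 0 < ε) (hβ : ∀ᶠ n in atTop, ε ≤ m n * β n) :
    ∀ᶠ n in atTop, (m n : ℝ) ^ (-(1 + δ)) < β n := by
  filter_upwards [hβ, hm.eventually_gt_atTop 0,
    (tendsto_natCast_rpow_neg hm hδ).eventually_lt_const hε] with n h1 h2 h3
  have h4 : (0 : ℝ) < m n := Nat.cast_pos.2 h2
  rw [neg_add, Real.rpow_add h4, Real.rpow_neg_one, inv_mul_lt_iff₀ h4]
  exact h3.trans_le h1

end Levels

/-! ### Two-sided bounds and limits of the probability. -/

section Bounds

variable {E : Type*} [MetricSpace E] {Ω : Type*} [MeasurableSpace Ω] {P : Measure Ω}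
  {ν : E → Measure ℝ} [∀ x, IsProbabilityMeasure (ν x)]
  {q : ℝ → E → ℝ} {γ : E → ℝ} {t : E} {h : ℕ → ℝ}
  {x : (n : ℕ) → Fin n → E} {Y : (n : ℕ) → Fin n → Ω → ℝ} {m : ℕ → ℕ} {δ : ℝ} {α : ℕ → ℝ}

theorem eventually_measureReal_le_exp (hq : IsConditionalQuantile ν q)
    (hheavy : IsHeavyTailed q γ) (hpos : ∀ n, 0 < h n)
    (hqpos : ∀ n, ∀ x ∈ Metric.closedBall t (h n), ∀ α ∈ Set.Ioo (0 : ℝ) 1, 0 < q α x)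
    (hlaw : ∀ n i, HasLaw (Y n i) (ν (x n i)) P) (hindep : ∀ n, iIndepFun (Y n) P)
    (hm : ∀ n, m n = sliceCount (x n) t (h n)) (hm_top : Tendsto m atTop atTop) (hδ : 0 < δ)
    (hosc : Tendsto (fun n => logOscillation q t (h n) ((m n : ℝ) ^ (-(1 + δ)))) atTop (𝓝 0))
    (hα : ∀ n, 0 < α n) (hα0 : Tendsto α atTop (𝓝 0)) {ε : ℝ} (hε : 0 < ε)
    (hmα : ∀ᶠ n in atTop, ε ≤ m n * α n) {lam : ℝ} (hlam0 : 0 < lam) (hlam : lam < 1) :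
    ∀ᶠ n in atTop, P.real {ω | sliceMax (x n) (fun i => Y n i ω) t (h n) < q (α n) t} ≤
      Real.exp (-(lam * (m n * α n))) := by
  have hlow : ∀ᶠ n in atTop, (m n : ℝ) ^ (-(1 + δ)) < lam * α n := by
    refine eventually_rpow_lt_of_le_mul hm_top hδ (mul_pos hlam0 hε) ?_
    filter_upwards [hmα] with n hn
    nlinarith
  filter_upwards [eventually_center_lt_quantile hheavy hpos hqpos hosc (fun n => by positivity)
    (tendsto_natCast_rpow_neg hm_top (by linarith)) hα hα0 hlam0 hlam hlow,
    hm_top.eventually_gt_atTop 0, hα0.eventually_lt_const one_pos] with n h1 h2 h3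
  have h4 : lam * α n < 1 := by nlinarith [hα n]
  have h5 : lam * α n ∈ Set.Ioo (0 : ℝ) 1 := ⟨mul_pos hlam0 (hα n), h4⟩
  refine (measureReal_sliceMax_lt_le_pow (hlaw n) (hindep n) (hm n ▸ h2)
    (p := 1 - lam * α n) fun z hz => ?_).trans ?_
  · rw [← hq z _ h5, cdf_eq_real]
    exact measureReal_mono fun w hw => (lt_trans hw (h1 z hz)).le
  · rw [← hm n, show lam * (m n * α n) = m n * (lam * α n) by ring]
    exact one_sub_pow_le_exp h4.le _

theorem eventually_exp_le_measureReal (hq : IsConditionalQuantile ν q)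
    (hheavy : IsHeavyTailed q γ) (hpos : ∀ n, 0 < h n)
    (hqpos : ∀ n, ∀ x ∈ Metric.closedBall t (h n), ∀ α ∈ Set.Ioo (0 : ℝ) 1, 0 < q α x)
    (hlaw : ∀ n i, HasLaw (Y n i) (ν (x n i)) P) (hindep : ∀ n, iIndepFun (Y n) P)
    (hm : ∀ n, m n = sliceCount (x n) t (h n)) (hm_top : Tendsto m atTop atTop) (hδ : 0 < δ)
    (hosc : Tendsto (fun n => logOscillation q t (h n) ((m n : ℝ) ^ (-(1 + δ)))) atTop (𝓝 0))
    (hα : ∀ n, 0 < α n) (hα0 : Tendsto α atTop (𝓝 0)) {ε : ℝ} (hε : 0 < ε)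
    (hmα : ∀ᶠ n in atTop, ε ≤ m n * α n) {lam : ℝ} (hlam : 1 < lam) :
    ∀ᶠ n in atTop, Real.exp (-(m n * (lam * α n) / (1 - lam * α n))) ≤
      P.real {ω | sliceMax (x n) (fun i => Y n i ω) t (h n) < q (α n) t} := by
  have hlam0 : 0 < lam := one_pos.trans hlam
  have hlow : ∀ᶠ n in atTop, (m n : ℝ) ^ (-(1 + δ)) < lam * α n := by
    refine eventually_rpow_lt_of_le_mul hm_top hδ (mul_pos hlam0 hε) ?_
    filter_upwards [hmα] with n hn
    nlinarith
  have hlim : Tendsto (fun n => lam * α n) atTop (𝓝 0) := by simpa using hα0.const_mul lam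
  filter_upwards [eventually_quantile_lt_center hheavy hpos hqpos hosc (fun n => by positivity)
    (tendsto_natCast_rpow_neg hm_top (by linarith)) hα hα0 hlam hlow,
    hm_top.eventually_gt_atTop 0, hlim.eventually_lt_const one_pos] with n h1 h2 h4
  have h5 : lam * α n ∈ Set.Ioo (0 : ℝ) 1 := ⟨mul_pos hlam0 (hα n), h4⟩
  refine le_trans ?_ (pow_le_measureReal_sliceMax_lt (hlaw n) (hindep n) (hm n ▸ h2)
    (p := 1 - lam * α n) (by linarith) fun z hz => ?_)
  · rw [← hm n]
    exact exp_le_one_sub_pow h4 _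
  · rw [← hq z _ h5, cdf_eq_real]
    -- Strictness of the quantile comparison puts the closed half-line inside the open one, so atoms
    -- do no harm.
    exact measureReal_mono fun w hw => lt_of_le_of_lt hw (h1 z hz)

theorem tendsto_measureReal_zero (hq : IsConditionalQuantile ν q)
    (hheavy : IsHeavyTailed q γ) (hpos : ∀ n, 0 < h n)
    (hqpos : ∀ n, ∀ x ∈ Metric.closedBall t (h n), ∀ α ∈ Set.Ioo (0 : ℝ) 1, 0 < q α x)
    (hlaw : ∀ n i, HasLaw (Y n i) (ν (x n i)) P) (hindep : ∀ n, iIndepFun (Y n) P)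
    (hm : ∀ n, m n = sliceCount (x n) t (h n)) (hm_top : Tendsto m atTop atTop) (hδ : 0 < δ)
    (hosc : Tendsto (fun n => logOscillation q t (h n) ((m n : ℝ) ^ (-(1 + δ)))) atTop (𝓝 0))
    (hα : ∀ n, 0 < α n) (hα0 : Tendsto α atTop (𝓝 0))
    (hmα : Tendsto (fun n => m n * α n) atTop atTop) :
    Tendsto (fun n => P.real {ω | sliceMax (x n) (fun i => Y n i ω) t (h n) < q (α n) t})
      atTop (𝓝 0) := by
  refine tendsto_of_tendsto_of_tendsto_of_le_of_le' tendsto_const_nhds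
    -- Any fixed `lam` in `(0, 1)` serves, as `lam * (m * α)` still diverges; here `lam = 1/2`.
    (Real.tendsto_exp_neg_atTop_nhds_zero.comp
      (hmα.const_mul_atTop (half_pos (one_pos (α := ℝ)))))
    (Eventually.of_forall fun n => measureReal_nonneg)
    (eventually_measureReal_le_exp hq hheavy hpos hqpos hlaw hindep hm hm_top hδ hosc hα hα0
      one_pos (hmα.eventually_ge_atTop 1) (by norm_num) (by norm_num))

variable [IsProbabilityMeasure P]

/-- Lower bound with a positive floor `η` on `m n * α n`, which covers the case `c = 0`. -/
theorem eventually_lt_measureReal (hq : IsConditionalQuantile ν q)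
    (hheavy : IsHeavyTailed q γ) (hpos : ∀ n, 0 < h n)
    (hqpos : ∀ n, ∀ x ∈ Metric.closedBall t (h n), ∀ α ∈ Set.Ioo (0 : ℝ) 1, 0 < q α x)
    (hlaw : ∀ n i, HasLaw (Y n i) (ν (x n i)) P) (hindep : ∀ n, iIndepFun (Y n) P)
    (hm : ∀ n, m n = sliceCount (x n) t (h n)) (hm_top : Tendsto m atTop atTop) (hδ : 0 < δ)
    (hosc : Tendsto (fun n => logOscillation q t (h n) ((m n : ℝ) ^ (-(1 + δ)))) atTop (𝓝 0))
    (hα : ∀ n, α n ∈ Set.Ioo (0 : ℝ) 1) (hα0 : Tendsto α atTop (𝓝 0)) {c : ℝ}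
    (hmα : Tendsto (fun n => m n * α n) atTop (𝓝 c)) {η : ℝ} (hη : 0 < η) {lam : ℝ}
    (hlam : 1 < lam) {v : ℝ} (hv : v < Real.exp (-(lam * max c η))) :
    ∀ᶠ n in atTop,
      v < P.real {ω | sliceMax (x n) (fun i => Y n i ω) t (h n) < q (α n) t} := by
  have hmtop : Tendsto (fun n => (m n : ℝ)) atTop atTop := tendsto_natCast_atTop_atTop.comp hm_top
  have hβ0 : Tendsto (fun n => max (α n) (η / m n)) atTop (𝓝 0) := by
    simpa using hα0.max (hmtop.const_div_atTop η)
  have hmul : ∀ᶠ n in atTop, max (m n * α n) η = m n * max (α n) (η / m n) := by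
    filter_upwards [hm_top.eventually_gt_atTop 0] with n hn
    have hn' : (0 : ℝ) < m n := Nat.cast_pos.2 hn
    rw [mul_max_of_nonneg _ _ hn'.le, mul_div_cancel₀ _ hn'.ne']
  have hmβ : Tendsto (fun n => m n * max (α n) (η / m n)) atTop (𝓝 (max c η)) :=
    (hmα.max tendsto_const_nhds).congr' hmul
  have hfloor : ∀ᶠ n in atTop, η ≤ m n * max (α n) (η / m n) := by
    filter_upwards [hmul] with n hn using hn ▸ le_max_right _ _
  have hlim : Tendsto (fun n => Real.exp (-(m n * (lam * max (α n) (η / m n)) /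
      (1 - lam * max (α n) (η / m n))))) atTop (𝓝 (Real.exp (-(lam * max c η)))) := by
    refine (Real.continuous_exp.tendsto _).comp (Tendsto.neg ?_)
    have h1 := (hmβ.const_mul lam).div ((hβ0.const_mul lam).const_sub 1) (by simp)
    simp only [mul_zero, sub_zero, div_one] at h1
    refine h1.congr fun n => ?_
    simp only [Pi.div_apply]
    ring
  filter_upwards [eventually_exp_le_measureReal hq hheavy hpos hqpos hlaw hindep hm hm_top hδ hosc
    (fun n => lt_max_of_lt_left (hα n).1) hβ0 hη hfloor hlam, hlim.eventually_const_lt hv,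
    hβ0.eventually_lt_const one_pos] with n h1 h2 h3
  -- The raised level has a smaller or equal quantile, so its event is contained in the one for `α
  -- n`.
  refine (h2.trans_le h1).trans_le (measureReal_mono fun ω hω =>
    show sliceMax (x n) (fun i => Y n i ω) t (h n) < q (α n) t from lt_of_lt_of_le hω ?_)
  rcases (le_max_left (α n) (η / m n)).eq_or_lt with heq | hlt
  · rw [← heq]
  · exact (hq.lt_of_lt t (hα n) ⟨lt_max_of_lt_left (hα n).1, h3⟩ hlt).le

theorem tendsto_measureReal_exp_neg (hq : IsConditionalQuantile ν q)
    (hheavy : IsHeavyTailed q γ) (hpos : ∀ n, 0 < h n)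
    (hqpos : ∀ n, ∀ x ∈ Metric.closedBall t (h n), ∀ α ∈ Set.Ioo (0 : ℝ) 1, 0 < q α x)
    (hlaw : ∀ n i, HasLaw (Y n i) (ν (x n i)) P) (hindep : ∀ n, iIndepFun (Y n) P)
    (hm : ∀ n, m n = sliceCount (x n) t (h n)) (hm_top : Tendsto m atTop atTop) (hδ : 0 < δ)
    (hosc : Tendsto (fun n => logOscillation q t (h n) ((m n : ℝ) ^ (-(1 + δ)))) atTop (𝓝 0))
    (hα : ∀ n, α n ∈ Set.Ioo (0 : ℝ) 1) (hα0 : Tendsto α atTop (𝓝 0)) {c : ℝ} (hc : 0 ≤ c)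
    (hmα : Tendsto (fun n => m n * α n) atTop (𝓝 c)) :
    Tendsto (fun n => P.real {ω | sliceMax (x n) (fun i => Y n i ω) t (h n) < q (α n) t})
      atTop (𝓝 (Real.exp (-c))) := by
  refine tendsto_order.2 ⟨fun v hv => ?_, fun v hv => ?_⟩
  -- The floor is tied to `lam` by `η = lam - 1`, so one limit removes both errors.
  · have hlim : Tendsto (fun lam : ℝ => Real.exp (-(lam * max c (lam - 1)))) (𝓝[>] 1)
        (𝓝 (Real.exp (-c))) := by
      have hcont : Continuous fun lam : ℝ => Real.exp (-(lam * max c (lam - 1))) := by fun_prop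
      have h1 := hcont.tendsto 1
      rw [sub_self, max_eq_left hc, one_mul] at h1
      exact h1.mono_left nhdsWithin_le_nhds
    obtain ⟨lam, hlam, hlt⟩ :=
      ((hlim.eventually_const_lt hv).and self_mem_nhdsWithin).exists.imp fun _ => And.symm
    exact eventually_lt_measureReal hq hheavy hpos hqpos hlaw hindep hm hm_top hδ hosc hα hα0 hmα
      (sub_pos.2 hlam) hlam hlt
  -- For `c = 0` the target is `1` and the upper bound is trivial; for `c > 0` the floor `c / 2` is
  -- available.
  · rcases hc.eq_or_lt with rfl | hc
    · rw [neg_zero, Real.exp_zero] at hv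
      exact Eventually.of_forall fun n => measureReal_le_one.trans_lt hv
    · have hlim : Tendsto (fun lam : ℝ => Real.exp (-(lam * c))) (𝓝[<] 1)
          (𝓝 (Real.exp (-c))) := by
        have hcont : Continuous fun lam : ℝ => Real.exp (-(lam * c)) := by fun_prop
        have h1 := hcont.tendsto 1
        rw [one_mul] at h1
        exact h1.mono_left nhdsWithin_le_nhds
      obtain ⟨lam, hlt, hlam0, hlam⟩ := ((hlim.eventually_lt_const hv).and
        (Ioo_mem_nhdsLT one_pos)).exists
      have hexp : Tendsto (fun n => Real.exp (-(lam * (m n * α n)))) atTop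
          (𝓝 (Real.exp (-(lam * c)))) :=
        (Real.continuous_exp.tendsto _).comp (hmα.const_mul lam).neg
      filter_upwards [eventually_measureReal_le_exp hq hheavy hpos hqpos hlaw hindep hm hm_top hδ
        hosc (fun n => (hα n).1) hα0 (half_pos hc) (hmα.eventually_const_le (half_lt_self hc))
        hlam0 hlam, hexp.eventually_lt_const hlt] with n h1 h2 using h1.trans_lt h2

end Bounds

end ConditionalExtremes

theorem proposition2
    {E : Type*} [MetricSpace E]
    {Ω : Type*} [MeasurableSpace Ω] (P : Measure Ω) [IsProbabilityMeasure P]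
    -- conditional laws, conditional quantiles and tail index
    (ν : E → Measure ℝ) [∀ x, IsProbabilityMeasure (ν x)]
    (q : ℝ → E → ℝ) (γ : E → ℝ)
    (hq : ConditionalExtremes.IsConditionalQuantile ν q)
    (hheavy : ConditionalExtremes.IsHeavyTailed q γ)
    -- the point of interest, with condition (A), and the window
    (t : E) (hA : ConditionalExtremes.ConditionA (fun α => q α t) (γ t))
    (h : ℕ → ℝ) (hpos : ∀ n, 0 < h n) (hzero : Tendsto h atTop (𝓝 0))
    -- the quantiles are positive on the windows, so that the log-quantiles make sense
    (hqpos : ∀ n, ∀ x ∈ Metric.closedBall t (h n), ∀ α ∈ Set.Ioo (0 : ℝ) 1, 0 < q α x)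
    -- for each sample size `n`: nonrandom design points and independent responses
    (x : (n : ℕ) → Fin n → E) (Y : (n : ℕ) → Fin n → Ω → ℝ)
    (hlaw : ∀ n i, HasLaw (Y n i) (ν (x n i)) P)
    (hindep : ∀ n, iIndepFun (Y n) P)
    -- the number of observations in the slice
    (m : ℕ → ℕ) (hm : ∀ n, m n = ConditionalExtremes.sliceCount (x n) t (h n))
    (hm_top : Tendsto m atTop atTop)
    -- the levels
    (α : ℕ → ℝ) (hα : ∀ n, α n ∈ Set.Ioo (0 : ℝ) 1)
    -- the oscillation condition
    (hosc : ∃ δ : ℝ, 0 < δ ∧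
      Tendsto (fun n => ConditionalExtremes.logOscillation q t (h n) ((m n : ℝ) ^ (-(1 + δ))))
        atTop (𝓝 0)) :
    (ConditionalExtremes.SituationOne m α →
      Tendsto (fun n => P.real {ω | ConditionalExtremes.sliceMax (x n) (fun i => Y n i ω) t (h n)
        < q (α n) t}) atTop (𝓝 0)) ∧
    (∀ c : ℝ, ConditionalExtremes.SituationTwo m α c ∨ ConditionalExtremes.SituationThree m α c →
      Tendsto (fun n => P.real {ω | ConditionalExtremes.sliceMax (x n) (fun i => Y n i ω) t (h n)
        < q (α n) t}) atTop (𝓝 (Real.exp (-c)))) := by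
  obtain ⟨δ, hδ, hosc⟩ := hosc
  refine ⟨fun ⟨hα0, hmα⟩ => ConditionalExtremes.tendsto_measureReal_zero hq hheavy hpos hqpos hlaw
    hindep hm hm_top hδ hosc (fun n => (hα n).1) hα0 hmα, ?_⟩
  rintro c (⟨hα0, hc, hmα, -⟩ | ⟨hα0, hc, -, hmα⟩)
  · exact ConditionalExtremes.tendsto_measureReal_exp_neg hq hheavy hpos hqpos hlaw hindep hm
      hm_top hδ hosc hα hα0 (zero_le_one.trans hc) hmα
  · exact ConditionalExtremes.tendsto_measureReal_exp_neg hq hheavy hpos hqpos hlaw hindep hm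
      hm_top hδ hosc hα hα0 hc hmα
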